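/- **Setting.** Let $\mathcal H$ be a real Hilbert space and let $\Phi,\Phi_1,\dots,\Phi_n:\mathcal H\to\mathbb R\cup\{+\infty\}$ be proper, convex and lower semicontinuous. Let $p_1,\dots,p_n>0$ with $\sum_i p_i=1$, and assume $\Phi=\sum_{i=1}^n p_i\Phi_i$, $\inf_{\mathcal H}\Phi_i>-\infty$ and $\operatorname{dom}\Phi\subset\operatorname{dom}\Phi_i\subset\overline{\operatorname{dom}\Phi}$ for all $i$. Let $\mathcal B_1,\dots,\mathcal B_m$ be nonempty sets (batches) with $\bigcup_j\mathcal B_j=\{1,\dots,n\}$, and let $\pi_1,\dots,\pi_m>0$ satisfy $p_i=\sum_{j:\,i\in\mathcal B_j}\pi_j|\mathcal B_j|^{-1}$ for all $i$. Put $\Phi_{\mathcal B}:=|\mathcal B|^{-1}\sum_{i\in\mathcal B}\Phi_i$. Let $\partial$ denote the convex subdifferential, $\operatorname{dom}\partial\Phi:=\{x:\partial\Phi(x)\neq\emptyset\}$, and let $\partial\Phi(x)^\circ$ be the element of minimal norm of $\partial\Phi(x)$. Assume the sum rule $\partial\Phi(x)=\sum_{j=1}^m\pi_j\,\partial\Phi_{\mathcal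 B_j}(x)$ for all $x\in\operatorname{dom}\partial\Phi$. Fix functions $\xi_1,\dots,\xi_m$ such that, for every $x\in\operatorname{dom}\partial\Phi$, $\xi_j(x)\in\partial\Phi_{\mathcal B_j}(x)$ for all $j$ and $\partial\Phi(x)^\circ=\sum_{j}\pi_j\xi_j(x)$, and set $$\Lambda(x):=\sum_{j=1}^m\pi_j\|\xi_j(x)-\partial\Phi(x)^\circ\|^2 .$$ Let $u_0\in\operatorname{dom}\partial\Phi$, and let $u:[0,\infty)\to\mathcal H$ be the strong solution of the gradient flow of $\Phi$ starting at $u_0$, i.e. $u$ is locally absolutely continuous, $u(0)=u_0$ and $0\in\dot u(t)+\partial\Phi(u(t))$ for a.e. $t\ge 0$. **Random scheme.** Let $(j_k)_{k\ge1}$ be independent random variables with $\mathbb P(j_k=j)=\pi_j$ for $j\in\{1,\dots,m\}$. For $\varepsilon>0$ let $w_0:=u_0$ and, for $k\ge 0$, let $$w_{k+1}\in\operatorname*{argmin}_{w\in\mathcal H}\Big\{\Phi_{\mathcal B_{j_{k+1}}}(w)+\tfrac1{2\varepsilon}\|w-w_k\|^2\Big\}$$ (the minimizer is unique), and set $w_\varepsilon(t):=w_k$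 for $t\in[(k-1)\varepsilon,k\varepsilon)$, $k\ge1$. A function $w:[0,\infty)\to\mathcal H$ is called a mini-batch minimizing movement if $\mathbb E\|w_\varepsilon(t)-w(t)\|^2\to0$ as $\varepsilon\to0^+$ for every $t\ge0$. **Theorem.** Assume that $\Lambda\circ u$ is locally bounded on $[0,\infty)$ and that $u\in C^1([0,\infty);\mathcal H)$. Then $u$ is a mini-batch minimizing movement. If, moreover, $\dot u$ is locally $\alpha$-Hölder continuous on $[0,\infty)$ for some $\alpha\in(0,1]$, then for every $T>0$ there is $c_T>0$ such that $$\sup_{t\in[0,T]}\mathbb E\|w_\varepsilon(t)-u(t)\|^2\le c_T\big(\varepsilon^{2\alpha}+\varepsilon^2+\varepsilon\big)\qquad\text{for all }\varepsilon>0 .$$ -/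

import Mathlib

open MeasureTheory ProbabilityTheory Set Filter Topology

noncomputable section

namespace MiniBatch

variable {H : Type*} [NormedAddCommGroup H] [InnerProductSpace ℝ H]

/-- A function `H → ℝ ∪ {+∞}` (an `EReal`-valued function that omits `⊥`) which is proper,
convex and lower semicontinuous. -/
structure IsProperConvexLSC (Φ : H → EReal) : Prop where
  ne_bot : ∀ x, Φ x ≠ ⊥
  proper : ∃ x, Φ x ≠ ⊤
  convex : ∀ x y : H, ∀ a b : ℝ, 0 ≤ a → 0 ≤ b → a + b = 1 →
    Φ (a • x + b • y) ≤ (a : EReal) * Φ x + (b : EReal) * Φ y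
  lsc : LowerSemicontinuous Φ

/-- The effective domain. -/
def effDom (Φ : H → EReal) : Set H := {x | Φ x ≠ ⊤}

/-- The convex subdifferential `∂Φ(x)`; it is empty outside the effective domain. -/
def subdiff (Φ : H → EReal) (x : H) : Set H :=
  {ξ | Φ x ≠ ⊤ ∧ ∀ y, Φ x + ((inner ℝ ξ (y - x) : ℝ) : EReal) ≤ Φ y}

/-- `dom ∂Φ`. -/
def domSubdiff (Φ : H → EReal) : Set H := {x | (subdiff Φ x).Nonempty}

/-- The minimal norm subgradient `∂Φ(x)°` (meaningful for `x ∈ dom ∂Φ`, where it exists and is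
unique as `∂Φ(x)` is a nonempty closed convex subset of a Hilbert space). -/
def minSubgrad (Φ : H → EReal) (x : H) : H :=
  Classical.epsilon fun ξ => ξ ∈ subdiff Φ x ∧ ∀ η ∈ subdiff Φ x, ‖ξ‖ ≤ ‖η‖

/-- The batch potential `Φ_B = |B|⁻¹ ∑_{i ∈ B} Φᵢ`. -/
def batchPotential {n : ℕ} (φ : Fin n → H → EReal) (B : Finset (Fin n)) (x : H) : EReal :=
  (((B.card : ℝ)⁻¹ : ℝ) : EReal) * ∑ i ∈ B, φ i x

/-- The standing assumptions: `Φ = ∑ pᵢ Φᵢ` is an average of sub-potentials `φ i = Φᵢ`, `B j` are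
the batches and `q j` is the probability of choosing the batch `B j`.
(That the `q j` add up to `1` follows from `sum_p`, `p_eq` and `batch_nonempty`.) -/
structure Setting {n m : ℕ} (p : Fin n → ℝ) (φ : Fin n → H → EReal) (Φ : H → EReal)
    (B : Fin m → Finset (Fin n)) (q : Fin m → ℝ) : Prop where
  potential : IsProperConvexLSC Φ
  p_pos : ∀ i, 0 < p i
  sum_p : ∑ i, p i = 1
  subpotential : ∀ i, IsProperConvexLSC (φ i)
  average : ∀ x, Φ x = ∑ i, (p i : EReal) * φ i x
  bddBelow : ∀ i, ⊥ < ⨅ x, φ i x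
  dom_subset : ∀ i, effDom Φ ⊆ effDom (φ i)
  dom_subset_closure : ∀ i, effDom (φ i) ⊆ closure (effDom Φ)
  batch_nonempty : ∀ j, (B j).Nonempty
  batch_cover : ∀ i, ∃ j, i ∈ B j
  q_pos : ∀ j, 0 < q j
  p_eq : ∀ i, p i = ∑ j with i ∈ B j, q j * ((B j).card : ℝ)⁻¹
  /-- The sum rule `∂Φ(x) = ∑ⱼ qⱼ ∂Φ_{Bⱼ}(x)` (Minkowski sum) on `dom ∂Φ`. -/
  sum_rule : ∀ x ∈ domSubdiff Φ, subdiff Φ x =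
    {v | ∃ ζ : Fin m → H, (∀ j, ζ j ∈ subdiff (batchPotential φ (B j)) x) ∧
      v = ∑ j, q j • ζ j}

/-- `ξ` splits the minimal norm subgradient: `ξⱼ(x) ∈ ∂Φ_{Bⱼ}(x)` and
`∂Φ(x)° = ∑ⱼ qⱼ ξⱼ(x)` for `x ∈ dom ∂Φ`. -/
def IsSplitting {n m : ℕ} (φ : Fin n → H → EReal) (Φ : H → EReal)
    (B : Fin m → Finset (Fin n)) (q : Fin m → ℝ) (ξ : Fin m → H → H) : Prop :=
  ∀ x ∈ domSubdiff Φ, (∀ j, ξ j x ∈ subdiff (batchPotential φ (B j)) x) ∧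
    minSubgrad Φ x = ∑ j, q j • ξ j x

/-- The variance `Λ(x) = ∑ⱼ qⱼ ‖ξⱼ(x) - ∂Φ(x)°‖²`. -/
def Lam {m : ℕ} (Φ : H → EReal) (q : Fin m → ℝ) (ξ : Fin m → H → H) (x : H) : ℝ :=
  ∑ j, q j * ‖ξ j x - minSubgrad Φ x‖ ^ 2

/-- `u : [0, ∞) → H` is a strong solution of `u' ∈ -∂Φ(u)`, `u(0) = u₀`
(the values of `u` at negative times play no role). -/
structure IsGradientFlow (Φ : H → EReal) (u₀ : H) (u : ℝ → H) : Prop where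
  locallyAC : ∀ T : ℝ, 0 < T → AbsolutelyContinuousOnInterval u 0 T
  initial : u 0 = u₀
  inclusion : ∀ᵐ t ∂(volume.restrict (Ioi (0 : ℝ))),
    ∃ d : H, HasDerivAt u d t ∧ -d ∈ subdiff Φ (u t)

/-- The proximal point: the minimizer of `w ↦ Ψ(w) + ‖w - v‖² / (2ε)` over `H`
(it exists and is unique for `ε > 0` and `Ψ` proper, convex and lower semicontinuous). -/
def proxPoint (Ψ : H → EReal) (ε : ℝ) (v : H) : H :=
  Classical.epsilon fun w =>
    IsMinOn (fun z => Ψ z + ((1 / (2 * ε) * ‖z - v‖ ^ 2 : ℝ) : EReal)) univ w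

/-- The proximal sequence `w₀ = u₀`,
`w_{k+1} ∈ argmin_w {Φ_{B_{J k}}(w) + ‖w - w_k‖² / (2ε)}`; here `J k` is the index of the batch
used in the step from `w_k` to `w_{k+1}`, that is the `(k+1)`-st chosen batch. -/
def proxSeq {n m : ℕ} (φ : Fin n → H → EReal) (B : Fin m → Finset (Fin n)) (u₀ : H) (ε : ℝ)
    (J : ℕ → Fin m) : ℕ → H
  | 0 => u₀
  | k + 1 => proxPoint (batchPotential φ (B (J k))) ε (proxSeq φ B u₀ ε J k)

/-- `k_t = min {k : t < t_k}` with `t_k = k ε`. -/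
def stepIndex (ε t : ℝ) : ℕ := sInf {k : ℕ | t < k * ε}

/-- The random piecewise constant function `w_ε(t) = w_{k_t}`, so `w_ε = w_k` on
`[t_{k-1}, t_k)`. -/
def wEps {n m : ℕ} {Ω : Type*} (φ : Fin n → H → EReal) (B : Fin m → Finset (Fin n)) (u₀ : H)
    (J : ℕ → Ω → Fin m) (ε t : ℝ) (ω : Ω) : H :=
  proxSeq φ B u₀ ε (fun k => J k ω) (stepIndex ε t)

/-- The random choices of batches: independent, and equal to `j` with probability `q j`. -/
structure IsBatchSampling {m : ℕ} {Ω : Type*} [MeasurableSpace Ω] (P : Measure Ω) (q : Fin m → ℝ)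
    (J : ℕ → Ω → Fin m) : Prop where
  measurable : ∀ k, Measurable (J k)
  indep : iIndepFun J P
  law : ∀ k j, P {ω | J k ω = j} = ENNReal.ofReal (q j)

/-- `w` is a mini-batch minimizing movement: `E ‖w_ε(t) - w(t)‖² → 0` as `ε → 0⁺` for all
`t ≥ 0`, the expectations being those of integrable random variables. -/
def IsMiniBatchMinimizingMovement {n m : ℕ} {Ω : Type*} [MeasurableSpace Ω] (P : Measure Ω)
    (φ : Fin n → H → EReal) (B : Fin m → Finset (Fin n)) (u₀ : H) (J : ℕ → Ω → Fin m)
    (w : ℝ → H) : Prop :=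
  ∀ t : ℝ, 0 ≤ t →
    (∀ ε : ℝ, 0 < ε → Integrable (fun ω => ‖wEps φ B u₀ J ε t ω - w t‖ ^ 2) P) ∧
    Tendsto (fun ε : ℝ => ∫ ω, ‖wEps φ B u₀ J ε t ω - w t‖ ^ 2 ∂P) (𝓝[>] 0) (𝓝 0)

/-- A real function on `[0, ∞)` is locally bounded. -/
def LocBddOnNonneg (f : ℝ → ℝ) : Prop :=
  ∀ T : ℝ, 0 < T → ∃ M : ℝ, ∀ t ∈ Icc 0 T, |f t| ≤ M

/-- A function on `[0, ∞)` is locally `α`-Hölder continuous. -/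
def LocHolderOnNonneg (α : ℝ) (f : ℝ → H) : Prop :=
  ∀ T : ℝ, 0 < T → ∃ L : ℝ, ∀ s ∈ Icc 0 T, ∀ t ∈ Icc 0 T, ‖f s - f t‖ ≤ L * |s - t| ^ α

end MiniBatch

end

/-! The flow is compared with the scheme one step at a time. For `ζ ∈ ∂Ψ(z)` the point `z` is the
proximal point of `z + ε ζ`, so monotonicity of `∂Ψ` bounds the distance from a proximal step to `z`
(`norm_proxPoint_sub_le`). Take `z = u(t)` and `ζ = ξⱼ(u(t))`, square, and average over the next
batch, which is independent of the past. The bias-variance identity leaves the deterministic error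
`‖w_k - u(t) - ε ∂Φ(u(t))°‖²` plus `ε² Λ(u(t))` (`integral_step_le`).

Since `u` is `C¹`, `∂Φ(u(t))° = -u'(t)` at every `t ≥ 0`. At `t = (k+1)ε` the deterministic part is
thus a Taylor remainder away from `w_k - u(kε)`. If `ρ` bounds the oscillation of `u'` at scale `ε`
and `M` bounds `Λ ∘ u`, Young's inequality gives `e_{k+1} ≤ (1+ε) e_k + ε ((1+ε)ρ² + εM)` for the
mean square errors. Discrete Gronwall (`integral_grid_le`) then yields a bound of order `ρ² + ε² +
ε`. Uniform continuity of `u'` on compact intervals makes `ρ` small; Hölder continuity makes it of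
order `ε^α`. -/

namespace MiniBatch


/-! ### Lower semicontinuity and extended-real sums. -/

/-- Closedness of the epigraph, in the form needed for minimizing sequences and for limits of
subgradients. -/
theorem lsc_le_of_tendsto {H : Type*} [TopologicalSpace H] {Ψ : H → EReal} (hΨ : LowerSemicontinuous Ψ)
    {ι : Type*} {l : Filter ι} [l.NeBot] {z : ι → H} {x : H} {b : ι → ℝ} {c : ℝ}
    (hz : Tendsto z l (𝓝 x)) (hb : Tendsto b l (𝓝 c)) (h : ∀ᶠ i in l, Ψ (z i) ≤ (b i : EReal)) :
    Ψ x ≤ (c : EReal) := by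
  refine le_of_forall_lt fun r hr => ?_
  by_contra! hc
  obtain ⟨s, hs1, hs2⟩ := EReal.lt_iff_exists_real_btwn.1 (lt_of_le_of_lt hc hr)
  have h1 : ∀ᶠ i in l, (s : EReal) < Ψ (z i) := hz.eventually (hΨ x s hs2)
  have h2 : ∀ᶠ i in l, b i < s := hb.eventually (gt_mem_nhds (by exact_mod_cast hs1))
  obtain ⟨i, h3, h4, h5⟩ := (h.and (h1.and h2)).exists
  have : (s : EReal) < (b i : EReal) := h4.trans_le h3
  exact absurd (by exact_mod_cast this) h5.not_gt

/-- On its effective domain a function without the value `⊥` is real valued. -/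
theorem exists_real_of_ne {H : Type*} {Ψ : H → EReal} (hΨ : ∀ x, Ψ x ≠ ⊥) {x : H} (hx : Ψ x ≠ ⊤) :
    ∃ r : ℝ, Ψ x = r := ⟨(Ψ x).toReal, (EReal.coe_toReal hx (hΨ x)).symm⟩

theorem coe_sum {ι : Type*} (s : Finset ι) (r : ι → ℝ) :
    ((∑ i ∈ s, r i : ℝ) : EReal) = ∑ i ∈ s, (r i : EReal) := by
  classical
  induction s using Finset.induction_on with
  | empty => simp
  | insert a s ha ih => rw [Finset.sum_insert ha, Finset.sum_insert ha, EReal.coe_add, ih]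

theorem sum_ne_bot {ι : Type*} (s : Finset ι) (f : ι → EReal) (h : ∀ i, f i ≠ ⊥) :
    ∑ i ∈ s, f i ≠ ⊥ := by
  classical
  induction s using Finset.induction_on with
  | empty => simp
  | insert a s ha ih =>
    rw [Finset.sum_insert ha]
    exact EReal.add_ne_bot_iff.2 ⟨h a, ih⟩

theorem sum_eq_top {ι : Type*} (s : Finset ι) (f : ι → EReal) (h : ∀ i, f i ≠ ⊥) {i : ι}
    (hi : i ∈ s) (hfi : f i = ⊤) : ∑ i ∈ s, f i = ⊤ := by
  classical
  rw [← Finset.add_sum_erase s f hi, hfi]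
  exact EReal.top_add_of_ne_bot (sum_ne_bot _ _ h)

theorem lowerSemicontinuous_finset_sum {H : Type*} [TopologicalSpace H] {ι : Type*} (s : Finset ι) (f : ι → H → EReal)
    (h : ∀ i x, f i x ≠ ⊥) (hl : ∀ i, LowerSemicontinuous (f i)) :
    LowerSemicontinuous fun x => ∑ i ∈ s, f i x := by
  classical
  induction s using Finset.induction_on with
  | empty => simpa using lowerSemicontinuous_const
  | insert a s ha ih =>
    simp only [Finset.sum_insert ha]
    refine (hl a).add' ih fun x => ?_
    refine EReal.continuousAt_add (Or.inr (sum_ne_bot s _ fun i => h i x)) (Or.inl (h a x))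

/-! ### The convex subdifferential. -/

variable {H : Type*} [NormedAddCommGroup H] [InnerProductSpace ℝ H]

theorem subdiff_real {Ψ : H → EReal} {x ξ y : H} (h : ξ ∈ subdiff Ψ x) {r s : ℝ}
    (hr : Ψ x = r) (hs : Ψ y = s) : r + inner ℝ ξ (y - x) ≤ s := by
  have := h.2 y
  rw [hr, hs] at this
  exact_mod_cast this

theorem mem_subdiff_of_real {Ψ : H → EReal} (hΨ : ∀ x, Ψ x ≠ ⊥) {x ξ : H} {r : ℝ} (hr : Ψ x = r)
    (h : ∀ y (s : ℝ), Ψ y = s → r + inner ℝ ξ (y - x) ≤ s) : ξ ∈ subdiff Ψ x := by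
  refine ⟨by simp [hr], fun y => ?_⟩
  by_cases hy : Ψ y = ⊤
  · simp [hy]
  · obtain ⟨s, hs⟩ := exists_real_of_ne hΨ hy
    rw [hr, hs]
    exact_mod_cast h y s hs

theorem subdiff_monotone {Ψ : H → EReal} (hΨ : ∀ x, Ψ x ≠ ⊥) {x y ξ η : H}
    (hξ : ξ ∈ subdiff Ψ x) (hη : η ∈ subdiff Ψ y) : 0 ≤ inner ℝ (ξ - η) (x - y) := by
  obtain ⟨r, hr⟩ := exists_real_of_ne hΨ hξ.1
  obtain ⟨s, hs⟩ := exists_real_of_ne hΨ hη.1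
  have h1 := subdiff_real hξ hr hs
  have h2 := subdiff_real hη hs hr
  simp only [inner_sub_left, inner_sub_right] at *
  linarith

theorem subdiff_midpoint {Ψ : H → EReal} (hΨ : ∀ x, Ψ x ≠ ⊥) {x ξ η : H}
    (hξ : ξ ∈ subdiff Ψ x) (hη : η ∈ subdiff Ψ x) :
    (1 / 2 : ℝ) • (ξ + η) ∈ subdiff Ψ x := by
  obtain ⟨r, hr⟩ := exists_real_of_ne hΨ hξ.1
  refine mem_subdiff_of_real hΨ hr fun y s hs => ?_
  have h1 := subdiff_real hξ hr hs
  have h2 := subdiff_real hη hr hs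
  rw [real_inner_smul_left, inner_add_left]
  linarith

/-- The subgradient inequality bounds `Ψ (z i)` by quantities that converge, so lower semicontinuity
carries it to the limit. Testing with one point of finite value shows that `Ψ x` is finite. -/
theorem subdiff_closed {Ψ : H → EReal} (hΨ : IsProperConvexLSC Ψ) {ι : Type*} {l : Filter ι}
    [l.NeBot] {z ζ : ι → H} {x ξ : H} (hz : Tendsto z l (𝓝 x)) (hζ : Tendsto ζ l (𝓝 ξ))
    (h : ∀ᶠ i in l, ζ i ∈ subdiff Ψ (z i)) : ξ ∈ subdiff Ψ x := by
  have key : ∀ y (s : ℝ), Ψ y = s → Ψ x ≤ ((s - inner ℝ ξ (y - x) : ℝ) : EReal) := by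
    intro y s hs
    refine lsc_le_of_tendsto hΨ.lsc hz
      (b := fun i => s - inner ℝ (ζ i) (y - z i))
      (tendsto_const_nhds.sub (hζ.inner (tendsto_const_nhds.sub hz))) ?_
    filter_upwards [h] with i hi
    obtain ⟨r, hr⟩ := exists_real_of_ne hΨ.ne_bot hi.1
    have := subdiff_real hi hr hs
    rw [hr, EReal.coe_le_coe_iff]
    linarith
  obtain ⟨y, hy⟩ := hΨ.proper
  obtain ⟨s, hs⟩ := exists_real_of_ne hΨ.ne_bot hy
  have hx : Ψ x ≠ ⊤ := ne_top_of_le_ne_top (EReal.coe_ne_top _) (key y s hs)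
  obtain ⟨r, hr⟩ := exists_real_of_ne hΨ.ne_bot hx
  refine mem_subdiff_of_real hΨ.ne_bot hr fun y s hs => ?_
  have := key y s hs
  rw [hr, EReal.coe_le_coe_iff] at this
  linarith

/-- Two subgradients of minimal norm have a midpoint that is again a subgradient, so the
parallelogram law forces them to coincide; the choice made by `Classical.epsilon` is therefore
determined. -/
theorem minSubgrad_eq {Ψ : H → EReal} (hΨ : ∀ x, Ψ x ≠ ⊥) {x ξ : H} (hξ : ξ ∈ subdiff Ψ x)
    (hmin : ∀ η ∈ subdiff Ψ x, ‖ξ‖ ≤ ‖η‖) : minSubgrad Ψ x = ξ := by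
  have hs : minSubgrad Ψ x ∈ subdiff Ψ x ∧ ∀ η ∈ subdiff Ψ x, ‖minSubgrad Ψ x‖ ≤ ‖η‖ :=
    Classical.epsilon_spec (p := fun ξ => ξ ∈ subdiff Ψ x ∧ ∀ η ∈ subdiff Ψ x, ‖ξ‖ ≤ ‖η‖)
      ⟨ξ, hξ, hmin⟩
  set η := minSubgrad Ψ x
  have h1 : ‖ξ‖ = ‖η‖ := le_antisymm (hmin _ hs.1) (hs.2 _ hξ)
  have h2 := hmin _ (subdiff_midpoint hΨ hξ hs.1)
  rw [norm_smul, Real.norm_of_nonneg (by norm_num)] at h2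
  have h3 := parallelogram_law_with_norm ℝ ξ η
  have h4 : ‖ξ - η‖ = 0 := by
    have : ‖ξ - η‖ * ‖ξ - η‖ ≤ 0 := by nlinarith [norm_nonneg ξ, norm_nonneg (ξ + η)]
    nlinarith [norm_nonneg (ξ - η)]
  exact (sub_eq_zero.1 (norm_eq_zero.1 h4)).symm

theorem IsProperConvexLSC.convex_real {Ψ : H → EReal} (hΨ : IsProperConvexLSC Ψ) {x y : H}
    {r s : ℝ} (hr : Ψ x = r) (hs : Ψ y = s) {a b : ℝ} (ha : 0 ≤ a) (hb : 0 ≤ b)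
    (hab : a + b = 1) : ∃ c : ℝ, Ψ (a • x + b • y) = c ∧ c ≤ a * r + b * s := by
  have h := hΨ.convex x y a b ha hb hab
  rw [hr, hs] at h
  have h' : Ψ (a • x + b • y) ≤ ((a * r + b * s : ℝ) : EReal) := by exact_mod_cast h
  obtain ⟨c, hc⟩ := exists_real_of_ne hΨ.ne_bot (ne_top_of_le_ne_top (EReal.coe_ne_top _) h')
  refine ⟨c, hc, ?_⟩
  rw [hc] at h'
  exact_mod_cast h'

/-! ### Batch potentials. -/

theorem batchPotential_real {H : Type*} {n : ℕ} {φ : Fin n → H → EReal} (B : Finset (Fin n)) {x : H}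
    {r : Fin n → ℝ} (hr : ∀ i ∈ B, φ i x = r i) :
    batchPotential φ B x = (((B.card : ℝ)⁻¹ * ∑ i ∈ B, r i : ℝ) : EReal) := by
  have : ∑ i ∈ B, φ i x = ((∑ i ∈ B, r i : ℝ) : EReal) := by
    rw [Finset.sum_congr rfl hr, coe_sum]
  rw [batchPotential, this, EReal.coe_mul]

theorem batchPotential_eq_top {H : Type*} {n : ℕ} {φ : Fin n → H → EReal} (hφ : ∀ i x, φ i x ≠ ⊥)
    {B : Finset (Fin n)} {x : H} {i : Fin n} (hi : i ∈ B) (hx : φ i x = ⊤) :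
    batchPotential φ B x = ⊤ := by
  rw [batchPotential, sum_eq_top B _ (fun i => hφ i x) hi hx]
  refine EReal.coe_mul_top_of_pos ?_
  have : 0 < B.card := Finset.card_pos.2 ⟨i, hi⟩
  positivity

theorem batchPotential_ne_top {H : Type*} {n : ℕ} {φ : Fin n → H → EReal} (hφ : ∀ i x, φ i x ≠ ⊥)
    {B : Finset (Fin n)} {x : H} (hx : batchPotential φ B x ≠ ⊤) :
    ∃ r : Fin n → ℝ, ∀ i ∈ B, φ i x = r i := by
  refine ⟨fun i => (φ i x).toReal, fun i hi => (EReal.coe_toReal (fun h => hx ?_) (hφ i x)).symm⟩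
  exact batchPotential_eq_top hφ hi h

theorem batchPotential_isProperConvexLSC {n : ℕ} {φ : Fin n → H → EReal}
    (hφ : ∀ i, IsProperConvexLSC (φ i)) {B : Finset (Fin n)} (hB : B.Nonempty)
    (hdom : ∃ x, ∀ i, φ i x ≠ ⊤) : IsProperConvexLSC (batchPotential φ B) := by
  have hb : ∀ i x, φ i x ≠ ⊥ := fun i => (hφ i).ne_bot
  have hB0 : (0 : ℝ) < (B.card : ℝ)⁻¹ := by
    have := Finset.card_pos.2 hB
    positivity
  have hnb : ∀ x, batchPotential φ B x ≠ ⊥ := by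
    intro x
    by_cases hx : batchPotential φ B x = ⊤
    · simp [hx]
    · obtain ⟨r, hr⟩ := batchPotential_ne_top hb hx
      rw [batchPotential_real B hr]
      exact EReal.coe_ne_bot _
  refine ⟨hnb, ?_, ?_, ?_⟩
  · obtain ⟨x, hx⟩ := hdom
    refine ⟨x, ?_⟩
    rw [batchPotential_real B (r := fun i => (φ i x).toReal)
      fun i _ => (EReal.coe_toReal (hx i) (hb i x)).symm]
    exact EReal.coe_ne_top _
  · intro x y a b ha hb' hab
    -- Zero weights are split off because `0 * ⊤ = 0` in `EReal`; with positive weights an infinite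
    -- value makes the right-hand side `⊤`.
    rcases ha.eq_or_lt with rfl | ha0
    · obtain rfl : b = 1 := by linarith
      simp
    rcases hb'.eq_or_lt with rfl | hb0
    · obtain rfl : a = 1 := by linarith
      simp
    have hpos : ∀ (c d : ℝ) (z w : H), 0 < d → batchPotential φ B w ≠ ⊥ →
        batchPotential φ B z = ⊤ → 0 < c →
        (c : EReal) * batchPotential φ B z + (d : EReal) * batchPotential φ B w = ⊤ := by
      intro c d z w hd hw hz hc
      rw [hz, EReal.coe_mul_top_of_pos hc]
      refine EReal.top_add_of_ne_bot ?_
      by_cases hw' : batchPotential φ B w = ⊤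
      · rw [hw', EReal.coe_mul_top_of_pos hd]; simp
      · rw [← EReal.coe_toReal hw' hw, ← EReal.coe_mul]
        exact EReal.coe_ne_bot _
    by_cases hx : batchPotential φ B x = ⊤
    · rw [hpos a b x y hb0 (hnb y) hx ha0]; exact le_top
    by_cases hy : batchPotential φ B y = ⊤
    · rw [add_comm ((a : EReal) * _), hpos b a y x ha0 (hnb x) hy hb0]; exact le_top
    obtain ⟨r, hr⟩ := batchPotential_ne_top hb hx
    obtain ⟨s, hs⟩ := batchPotential_ne_top hb hy
    have hc : ∀ i, ∃ c : ℝ, i ∈ B → φ i (a • x + b • y) = c ∧ c ≤ a * r i + b * s i := by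
      intro i
      by_cases hi : i ∈ B
      · obtain ⟨c, hc⟩ := (hφ i).convex_real (hr i hi) (hs i hi) ha hb' hab
        exact ⟨c, fun _ => hc⟩
      · exact ⟨0, fun h => absurd h hi⟩
    choose c hc using hc
    rw [batchPotential_real B hr, batchPotential_real B hs,
      batchPotential_real B fun i hi => (hc i hi).1]
    norm_cast
    calc (B.card : ℝ)⁻¹ * ∑ i ∈ B, c i ≤ (B.card : ℝ)⁻¹ * ∑ i ∈ B, (a * r i + b * s i) := by
          gcongr with i hi
          exact (hc i hi).2
      _ = _ := by rw [Finset.sum_add_distrib, ← Finset.mul_sum, ← Finset.mul_sum]; ring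
  · have h1 := lowerSemicontinuous_finset_sum B φ hb fun i => (hφ i).lsc
    have h0 : (((B.card : ℝ)⁻¹ : ℝ) : EReal) ≠ 0 := by exact_mod_cast hB0.ne'
    have hcont : Continuous fun x : EReal => (((B.card : ℝ)⁻¹ : ℝ) : EReal) * x := by
      refine continuous_iff_continuousAt.2 fun x => ?_
      exact ContinuousAt.comp (f := fun x => ((((B.card : ℝ)⁻¹ : ℝ) : EReal), x))
        (EReal.continuousAt_mul (Or.inl h0) (Or.inl h0) (Or.inl (EReal.coe_ne_bot _))
          (Or.inl (EReal.coe_ne_top _))) (by fun_prop)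
    refine hcont.comp_lowerSemicontinuous h1 ?_
    intro x y hxy
    exact mul_le_mul_of_nonneg_left hxy (by exact_mod_cast hB0.le)

theorem batchPotential_bddBelow {H : Type*} {n : ℕ} {φ : Fin n → H → EReal} (hφ : ∀ i x, φ i x ≠ ⊥)
    (hbd : ∀ i, ⊥ < ⨅ x, φ i x) (B : Finset (Fin n)) :
    ∃ c : ℝ, ∀ x, (c : EReal) ≤ batchPotential φ B x := by
  choose c _ hc using fun i => EReal.lt_iff_exists_real_btwn.1 (hbd i)
  refine ⟨(B.card : ℝ)⁻¹ * ∑ i ∈ B, c i, fun x => ?_⟩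
  by_cases hx : batchPotential φ B x = ⊤
  · simp [hx]
  obtain ⟨r, hr⟩ := batchPotential_ne_top hφ hx
  rw [batchPotential_real B hr, EReal.coe_le_coe_iff]
  gcongr with i hi
  have := (hc i).le.trans (iInf_le _ x)
  rw [hr i hi] at this
  exact_mod_cast this

/-! ### The proximal map. -/

/-- Direct method without compactness: the quadratic term makes the functional strongly convex, so a
minimizing sequence is Cauchy and lower semicontinuity makes its limit a minimizer. -/
theorem exists_isMinOn_prox [CompleteSpace H] {Ψ : H → EReal} (hΨ : IsProperConvexLSC Ψ)
    (hbd : ∃ c : ℝ, ∀ x, (c : EReal) ≤ Ψ x) {a : ℝ} (ha : 0 < a) (v : H) :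
    ∃ w, IsMinOn (fun z => Ψ z + ((a * ‖z - v‖ ^ 2 : ℝ) : EReal)) univ w := by
  obtain ⟨c, hc⟩ := hbd
  set S : Set ℝ := {g | ∃ z r, Ψ z = ((r : ℝ) : EReal) ∧ g = r + a * ‖z - v‖ ^ 2} with hS
  have hSne : S.Nonempty := by
    obtain ⟨x, hx⟩ := hΨ.proper
    obtain ⟨r, hr⟩ := exists_real_of_ne hΨ.ne_bot hx
    exact ⟨_, x, r, hr, rfl⟩
  have hSbd : BddBelow S := by
    refine ⟨c, ?_⟩
    rintro _ ⟨z, r, hr, rfl⟩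
    have := hc z
    rw [hr, EReal.coe_le_coe_iff] at this
    have : 0 ≤ a * ‖z - v‖ ^ 2 := by positivity
    linarith
  set μ := sInf S
  have hex : ∀ k : ℕ, ∃ z : H, ∃ r : ℝ, Ψ z = r ∧ r + a * ‖z - v‖ ^ 2 < μ + 1 / ((k : ℝ) + 1) := by
    intro k
    obtain ⟨_, ⟨z, r, hr, rfl⟩, h⟩ := exists_lt_of_csInf_lt hSne
      (show sInf S < μ + 1 / ((k : ℝ) + 1) from lt_add_of_pos_right _ (by positivity))
    exact ⟨z, r, hr, h⟩
  choose z r hr hz using hex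
  -- The midpoint of `z k` and `z l` is a competitor for the infimum; the parallelogram law produces
  -- the quadratic gain.
  have hmid : ∀ k l, a * ‖z k - z l‖ ^ 2 ≤ 2 * (1 / ((k : ℝ) + 1) + 1 / ((l : ℝ) + 1)) := by
    intro k l
    obtain ⟨d, hd, hd'⟩ := hΨ.convex_real (hr k) (hr l) (a := 1 / 2) (b := 1 / 2) (by norm_num)
      (by norm_num) (by norm_num)
    have h1 : μ ≤ d + a * ‖((1 / 2 : ℝ) • z k + (1 / 2 : ℝ) • z l) - v‖ ^ 2 :=
      csInf_le hSbd ⟨_, d, hd, rfl⟩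
    have h2 : ‖((1 / 2 : ℝ) • z k + (1 / 2 : ℝ) • z l) - v‖ ^ 2 =
        1 / 2 * ‖z k - v‖ ^ 2 + 1 / 2 * ‖z l - v‖ ^ 2 - 1 / 4 * ‖z k - z l‖ ^ 2 := by
      have e1 : ((1 / 2 : ℝ) • z k + (1 / 2 : ℝ) • z l) - v =
          (1 / 2 : ℝ) • ((z k - v) + (z l - v)) := by module
      have e2 : z k - z l = (z k - v) - (z l - v) := by abel
      rw [e1, e2, norm_smul, mul_pow, Real.norm_of_nonneg (by norm_num), norm_add_sq_real,
        norm_sub_sq_real (z k - v) (z l - v)]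
      ring
    rw [h2] at h1
    nlinarith [hz k, hz l]
  have hlim : Tendsto (fun k : ℕ => 1 / ((k : ℝ) + 1)) atTop (𝓝 0) :=
    tendsto_one_div_add_atTop_nhds_zero_nat
  have hcau : CauchySeq z := by
    refine cauchySeq_of_le_tendsto_0 (fun N : ℕ => √(4 / a * (1 / ((N : ℝ) + 1)))) ?_ ?_
    · intro k l N hk hl
      rw [dist_eq_norm]
      refine Real.le_sqrt_of_sq_le ?_
      have h1 : 1 / ((k : ℝ) + 1) ≤ 1 / ((N : ℝ) + 1) := by gcongr
      have h2 : 1 / ((l : ℝ) + 1) ≤ 1 / ((N : ℝ) + 1) := by gcongr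
      have h3 := hmid k l
      rw [div_mul_eq_mul_div, le_div_iff₀ ha]
      linarith
    · have := (hlim.const_mul (4 / a)).sqrt
      simpa using this
  obtain ⟨w, hw⟩ := cauchySeq_tendsto_of_complete hcau
  have hle : Ψ w ≤ ((μ - a * ‖w - v‖ ^ 2 : ℝ) : EReal) := by
    refine lsc_le_of_tendsto hΨ.lsc hw
      (b := fun k : ℕ => μ + 1 / ((k : ℝ) + 1) - a * ‖z k - v‖ ^ 2) ?_ ?_
    · have h1 := ((hw.sub_const v).norm.pow 2).const_mul a
      simpa using (hlim.const_add μ).sub h1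
    · refine Eventually.of_forall fun k => ?_
      rw [hr k, EReal.coe_le_coe_iff]
      linarith [hz k]
  obtain ⟨s, hs⟩ := exists_real_of_ne hΨ.ne_bot (ne_top_of_le_ne_top (EReal.coe_ne_top _) hle)
  rw [hs, EReal.coe_le_coe_iff] at hle
  refine ⟨w, fun y _ => ?_⟩
  by_cases hy : Ψ y = ⊤
  · simp only [mem_ofPred_eq, hy, EReal.top_add_coe]; exact le_top
  obtain ⟨t, ht⟩ := exists_real_of_ne hΨ.ne_bot hy
  have : μ ≤ t + a * ‖y - v‖ ^ 2 := csInf_le hSbd ⟨y, t, ht, rfl⟩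
  simp only [mem_ofPred_eq, hs, ht]
  norm_cast
  linarith

/-- The optimality condition of the proximal step. -/
theorem mem_subdiff_of_isMinOn {Ψ : H → EReal} (hΨ : IsProperConvexLSC Ψ) {a : ℝ} {v w : H}
    (h : IsMinOn (fun z => Ψ z + ((a * ‖z - v‖ ^ 2 : ℝ) : EReal)) univ w) :
    (2 * a) • (v - w) ∈ subdiff Ψ w := by
  have hmin : ∀ y, Ψ w + ((a * ‖w - v‖ ^ 2 : ℝ) : EReal) ≤ Ψ y + ((a * ‖y - v‖ ^ 2 : ℝ) : EReal) :=
    fun y => h (mem_univ y)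
  have hw : Ψ w ≠ ⊤ := by
    intro hw
    obtain ⟨y, hy⟩ := hΨ.proper
    have := hmin y
    rw [hw, EReal.top_add_coe, top_le_iff] at this
    exact EReal.add_ne_top hy (EReal.coe_ne_top _) this
  obtain ⟨r, hr⟩ := exists_real_of_ne hΨ.ne_bot hw
  refine mem_subdiff_of_real hΨ.ne_bot hr fun y s hs => ?_
  -- Minimality is tested at `w + θ (y - w)` and divided by `θ`; the error is of order `θ` and
  -- vanishes as `θ → 0⁺`.
  have key : ∀ θ : ℝ, 0 < θ → θ < 1 →
      r + inner ℝ ((2 * a) • (v - w)) (y - w) ≤ s + θ * (a * ‖y - w‖ ^ 2) := by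
    intro θ h0 h1
    obtain ⟨c, hc, hc'⟩ := hΨ.convex_real hr hs (a := 1 - θ) (b := θ) (by linarith) h0.le (by ring)
    have h2 := hmin ((1 - θ) • w + θ • y)
    rw [hr, hc] at h2
    have h3 : r + a * ‖w - v‖ ^ 2 ≤ c + a * ‖(1 - θ) • w + θ • y - v‖ ^ 2 := by exact_mod_cast h2
    have e1 : (1 - θ) • w + θ • y - v = (w - v) + θ • (y - w) := by module
    have e2 : inner ℝ (v - w) (y - w) = - inner ℝ (w - v) (y - w) := by
      rw [← inner_neg_left, neg_sub]
    rw [e1, norm_add_sq_real, norm_smul, mul_pow, Real.norm_of_nonneg h0.le,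
      real_inner_smul_right] at h3
    rw [real_inner_smul_left, e2]
    refine le_of_mul_le_mul_left ?_ h0
    nlinarith
  have ht : Tendsto (fun θ : ℝ => s + θ * (a * ‖y - w‖ ^ 2)) (𝓝[>] 0) (𝓝 s) := by
    have : Continuous fun θ : ℝ => s + θ * (a * ‖y - w‖ ^ 2) := by fun_prop
    simpa using (this.tendsto 0).mono_left nhdsWithin_le_nhds
  refine ge_of_tendsto ht ?_
  filter_upwards [Ioo_mem_nhdsGT (zero_lt_one' ℝ)] with θ hθ using key θ hθ.1 hθ.2

/-- Nonexpansiveness of the proximal map, tested at the proximal point `z` of `z + ε ζ`. -/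
theorem norm_proxPoint_sub_le [CompleteSpace H] {Ψ : H → EReal} (hΨ : IsProperConvexLSC Ψ)
    (hbd : ∃ c : ℝ, ∀ x, (c : EReal) ≤ Ψ x) {ε : ℝ} (hε : 0 < ε) (v : H) {z ζ : H}
    (hζ : ζ ∈ subdiff Ψ z) : ‖proxPoint Ψ ε v - z‖ ≤ ‖v - z - ε • ζ‖ := by
  have hmin := Classical.epsilon_spec
    (exists_isMinOn_prox hΨ hbd (a := 1 / (2 * ε)) (by positivity) v)
  have hw := mem_subdiff_of_isMinOn hΨ hmin
  change _ ∈ subdiff Ψ (proxPoint Ψ ε v) at hw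
  change (2 * (1 / (2 * ε))) • (v - proxPoint Ψ ε v) ∈ _ at hw
  set w := proxPoint Ψ ε v
  have h1 := subdiff_monotone hΨ.ne_bot hw hζ
  -- Monotonicity multiplied by `ε`; Cauchy-Schwarz then gives the norm bound.
  have h2 : 0 ≤ inner ℝ ((v - z - ε • ζ) - (w - z)) (w - z) := by
    have e : (v - z - ε • ζ) - (w - z) = ε • ((2 * (1 / (2 * ε))) • (v - w) - ζ) := by
      rw [smul_sub, smul_smul, show ε * (2 * (1 / (2 * ε))) = 1 by field_simp, one_smul]
      abel
    rw [e, real_inner_smul_left]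
    positivity
  rw [inner_sub_left, real_inner_self_eq_norm_sq] at h2
  have h3 := real_inner_le_norm (v - z - ε • ζ) (w - z)
  by_contra! hlt
  have : 0 < ‖w - z‖ := (norm_nonneg _).trans_lt hlt
  nlinarith

end MiniBatch

namespace MiniBatch

variable {H : Type*} [NormedAddCommGroup H] [InnerProductSpace ℝ H]

/-! ### Gradient flows of class `C¹`. -/

section Flow

variable {Φ : H → EReal} {u₀ : H} {u : ℝ → H}

theorem hasDerivWithinAt_of_contDiffOn (hC1 : ContDiffOn ℝ 1 u (Ici 0)) {t : ℝ} (ht : 0 ≤ t) :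
    HasDerivWithinAt u (derivWithin u (Ici 0) t) (Ici 0) t :=
  ((hC1.differentiableOn one_ne_zero) t ht).hasDerivWithinAt

theorem continuousOn_derivWithin_of_contDiffOn (hC1 : ContDiffOn ℝ 1 u (Ici 0)) :
    ContinuousOn (derivWithin u (Ici 0)) (Ici 0) :=
  hC1.continuousOn_derivWithin (uniqueDiffOn_Ici 0) le_rfl

/-- For a `C¹` gradient flow the inclusion holds at all times, by closedness of `∂Φ`. -/
theorem IsGradientFlow.neg_derivWithin_mem (hΦ : IsProperConvexLSC Φ)
    (hu : IsGradientFlow Φ u₀ u) (hC1 : ContDiffOn ℝ 1 u (Ici 0)) {t : ℝ} (ht : 0 ≤ t) :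
    -derivWithin u (Ici 0) t ∈ subdiff Φ (u t) := by
  have hae := (ae_restrict_iff' measurableSet_Ioi).1 hu.inclusion
  have hD := Measure.dense_of_ae hae
  set A := {s : ℝ | s ∈ Ioi (0 : ℝ) → ∃ d : H, HasDerivAt u d s ∧ -d ∈ subdiff Φ (u s)}
  -- Times at which the inclusion holds are dense, and approaching `t` from the right also covers `t
  -- = 0`.
  have hcl : t ∈ closure (Ioi t ∩ A) := by
    have h1 : Ioi t ⊆ closure (Ioi t ∩ A) := hD.open_subset_closure_inter isOpen_Ioi
    have h2 := closure_minimal h1 isClosed_closure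
    rw [closure_Ioi] at h2
    exact h2 self_mem_Ici
  have : (𝓝[Ioi t ∩ A] t).NeBot := mem_closure_iff_nhdsWithin_neBot.1 hcl
  have hsub : Ioi t ∩ A ⊆ Ici 0 := fun s hs => ht.trans (le_of_lt hs.1)
  have hmono := nhdsWithin_mono t hsub
  refine subdiff_closed hΦ (l := 𝓝[Ioi t ∩ A] t)
    ((hC1.continuousOn t ht).tendsto.mono_left hmono)
    (((continuousOn_derivWithin_of_contDiffOn hC1) t ht).tendsto.neg.mono_left hmono) ?_
  filter_upwards [self_mem_nhdsWithin] with s hs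
  have hs0 : 0 < s := ht.trans_lt hs.1
  obtain ⟨d, hd, hd'⟩ := hs.2 hs0
  rwa [hd.hasDerivWithinAt.derivWithin (uniqueDiffOn_Ici 0 s hs0.le)]

/-- A `C¹` gradient flow moves with the minimal norm subgradient. -/
theorem IsGradientFlow.minSubgrad_eq_neg_derivWithin (hΦ : IsProperConvexLSC Φ)
    (hu : IsGradientFlow Φ u₀ u) (hC1 : ContDiffOn ℝ 1 u (Ici 0)) {t : ℝ} (ht : 0 ≤ t) :
    minSubgrad Φ (u t) = -derivWithin u (Ici 0) t := by
  have hmem : ∀ s : ℝ, 0 ≤ s → -derivWithin u (Ici 0) s ∈ subdiff Φ (u s) :=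
    fun s hs => hu.neg_derivWithin_mem hΦ hC1 hs
  refine minSubgrad_eq hΦ.ne_bot (hmem t ht) fun ξ hξ => ?_
  set v := derivWithin u (Ici 0)
  have hsub : Ioi t ⊆ Ici 0 := fun s hs => ht.trans (le_of_lt hs)
  have hslope : Tendsto (slope u t) (𝓝[>] t) (𝓝 (v t)) :=
    (hasDerivWithinAt_iff_tendsto_slope' self_notMem_Ioi).1
      ((hasDerivWithinAt_of_contDiffOn hC1 ht).mono hsub)
  have hv : Tendsto v (𝓝[>] t) (𝓝 (v t)) :=
    ((continuousOn_derivWithin_of_contDiffOn hC1) t ht).tendsto.mono_left (nhdsWithin_mono t hsub)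
  -- Monotonicity between `ξ` at `u t` and `-v s` at `u s`, divided by `s - t`, as `s → t⁺`. It
  -- gives `‖v t‖² ≤ -⟨ξ, v t⟩ ≤ ‖ξ‖ ‖v t‖`.
  have hle : inner ℝ (ξ + v t) (v t) ≤ 0 := by
    refine le_of_tendsto ((tendsto_const_nhds.add hv).inner hslope) ?_
    filter_upwards [self_mem_nhdsWithin] with s hs
    have h1 := subdiff_monotone hΦ.ne_bot hξ (hmem s (hsub hs))
    have h2 : inner ℝ (ξ + v s) (u s - u t) ≤ 0 := by
      rw [sub_neg_eq_add, ← neg_sub (u s), inner_neg_right] at h1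
      linarith
    rw [slope_def_module, real_inner_smul_right]
    exact mul_nonpos_of_nonneg_of_nonpos (inv_nonneg.2 (sub_nonneg.2 (le_of_lt hs))) h2
  rw [inner_add_left, real_inner_self_eq_norm_sq] at hle
  rw [norm_neg]
  have h3 := abs_le.1 (abs_real_inner_le_norm ξ (v t))
  by_contra! hlt
  have : 0 < ‖v t‖ := (norm_nonneg _).trans_lt hlt
  nlinarith

end Flow

/-! ### Taylor, variance and Young estimates. -/

/-- First order Taylor estimate on `[s, t]` by the oscillation of the derivative. -/
theorem norm_sub_sub_smul_le {u v : ℝ → H} {s t ρ : ℝ} (hst : s ≤ t)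
    (hu : ∀ r ∈ Icc s t, HasDerivWithinAt u (v r) (Icc s t) r)
    (hv : ∀ r ∈ Icc s t, ‖v r - v t‖ ≤ ρ) :
    ‖u t - u s - (t - s) • v t‖ ≤ ρ * (t - s) := by
  have h := (convex_Icc s t).norm_image_sub_le_of_norm_hasDerivWithin_le
    (f := fun r => u r - r • v t) (f' := fun r => v r - (1 : ℝ) • v t)
    (fun r hr => (hu r hr).sub ((hasDerivWithinAt_id r _).smul_const (v t)))
    (fun r hr => by simpa using hv r hr) (left_mem_Icc.2 hst) (right_mem_Icc.2 hst)
  rw [Real.norm_of_nonneg (sub_nonneg.2 hst)] at h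
  convert h using 2
  module

/-- Bias-variance decomposition: the cross term vanishes because the weighted deviations from the
mean sum to zero. -/
theorem sum_mul_norm_sub_smul_sq {m : ℕ} {q : Fin m → ℝ} (hq : ∑ j, q j = 1) (ζ : Fin m → H)
    (y : H) (ε : ℝ) : ∑ j, q j * ‖y - ε • ζ j‖ ^ 2 =
      ‖y - ε • ∑ j, q j • ζ j‖ ^ 2 + ε ^ 2 * ∑ j, q j * ‖ζ j - ∑ i, q i • ζ i‖ ^ 2 := by
  set b := ∑ j, q j • ζ j with hb
  have h1 : ∀ j, q j * ‖y - ε • ζ j‖ ^ 2 = q j * ‖y - ε • b‖ ^ 2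
      - 2 * ε * inner ℝ (y - ε • b) (q j • ζ j - q j • b) + ε ^ 2 * (q j * ‖ζ j - b‖ ^ 2) := by
    intro j
    have e : y - ε • ζ j = (y - ε • b) - ε • (ζ j - b) := by module
    rw [e, norm_sub_sq_real, norm_smul, mul_pow, real_inner_smul_right, ← smul_sub,
      real_inner_smul_right, Real.norm_eq_abs, sq_abs]
    ring
  rw [Finset.sum_congr rfl fun j _ => h1 j, Finset.sum_add_distrib, Finset.sum_sub_distrib,
    ← Finset.sum_mul, hq, ← Finset.mul_sum, ← Finset.mul_sum, ← inner_sum, Finset.sum_sub_distrib,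
    ← Finset.sum_smul, hq, ← hb]
  simp

/-- Young's inequality with the step size as weight: the factor `1 + ε` compounds to at most `exp T`
over the steps up to time `T`. -/
theorem norm_add_sq_le_of_pos {H : Type*} [SeminormedAddCommGroup H] (a b : H) {ε : ℝ} (hε : 0 < ε) :
    ‖a + b‖ ^ 2 ≤ (1 + ε) * ‖a‖ ^ 2 + (1 + ε⁻¹) * ‖b‖ ^ 2 := by
  have h1 : ‖a + b‖ ^ 2 ≤ (‖a‖ + ‖b‖) ^ 2 := by gcongr; exact norm_add_le a b
  have h2 : 0 ≤ ε⁻¹ * (ε * ‖a‖ - ‖b‖) ^ 2 := by positivity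
  have h3 : ε⁻¹ * (ε * ‖a‖ - ‖b‖) ^ 2 = ε * ‖a‖ ^ 2 - 2 * ‖a‖ * ‖b‖ + ε⁻¹ * ‖b‖ ^ 2 := by
    field_simp
    ring
  linarith

theorem norm_add_sq_le_two {H : Type*} [SeminormedAddCommGroup H] (a b : H) : ‖a + b‖ ^ 2 ≤ 2 * ‖a‖ ^ 2 + 2 * ‖b‖ ^ 2 := by
  have := norm_add_sq_le_of_pos a b one_pos
  norm_num at this
  exact this

/-! ### Random batches and the expected one-step estimate. -/

section Sampling

variable {Ω : Type*} [MeasurableSpace Ω] {P : Measure Ω} {n m : ℕ}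
  {φ : Fin n → H → EReal} {B : Fin m → Finset (Fin n)} {q : Fin m → ℝ} {J : ℕ → Ω → Fin m}

/-- The choices made in the first `k` steps. -/
def history (J : ℕ → Ω → Fin m) (k : ℕ) (ω : Ω) (i : Finset.range k) : Fin m := J i ω

theorem IsBatchSampling.measurable_history (hJ : IsBatchSampling P q J) (k : ℕ) :
    Measurable (history J k) :=
  measurable_pi_lambda _ fun i => hJ.measurable i

theorem proxSeq_congr {H : Type*} [NormedAddCommGroup H] {φ : Fin n → H → EReal} (u₀ : H) (ε : ℝ) {a b : ℕ → Fin m} {k : ℕ} (h : ∀ i < k, a i = b i) :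
    proxSeq φ B u₀ ε a k = proxSeq φ B u₀ ε b k := by
  induction k with
  | zero => rfl
  | succ k ih => rw [proxSeq, proxSeq, ih fun i hi => h i (by omega), h k (by omega)]

/-- The iterate factors through a finite discrete space, so every real function of it is integrable
without any measurability of the proximal map. -/
theorem exists_proxSeq_eq_history {Ω H : Type*} [NormedAddCommGroup H] [Nonempty Ω] (φ : Fin n → H → EReal)
    (B : Fin m → Finset (Fin n)) (J : ℕ → Ω → Fin m) (u₀ : H) (ε : ℝ) (k : ℕ) :
    ∃ G : (Finset.range k → Fin m) → H, ∀ ω,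
      proxSeq φ B u₀ ε (fun i => J i ω) k = G (history J k ω) := by
  obtain ⟨ω₀⟩ := ‹Nonempty Ω›
  -- `J 0 ω₀` only fills the indices from `k` on, which the first `k` steps never read.
  refine ⟨fun a => proxSeq φ B u₀ ε
    (fun i => if h : i ∈ Finset.range k then a ⟨i, h⟩ else J 0 ω₀) k, fun ω => ?_⟩
  refine proxSeq_congr u₀ ε fun i hi => ?_
  rw [dif_pos (Finset.mem_range.2 hi)]
  rfl

theorem IsBatchSampling.integrable_comp_history [IsFiniteMeasure P] (hJ : IsBatchSampling P q J)
    (k : ℕ) (f : (Finset.range k → Fin m) → ℝ) : Integrable (fun ω => f (history J k ω)) P :=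
  (Integrable.of_finite (μ := P.map (history J k)) (f := f)).comp_measurable
    (hJ.measurable_history k)

theorem IsBatchSampling.integrable_comp_proxSeq {H : Type*} [NormedAddCommGroup H]
    {φ : Fin n → H → EReal} [IsProbabilityMeasure P]
    (hJ : IsBatchSampling P q J) (u₀ : H) (ε : ℝ) (k : ℕ) (f : H → ℝ) :
    Integrable (fun ω => f (proxSeq φ B u₀ ε (fun i => J i ω) k)) P := by
  have : Nonempty Ω := P.nonempty_of_neZero
  obtain ⟨G, hG⟩ := exists_proxSeq_eq_history φ B J u₀ ε k
  simp only [hG]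
  exact hJ.integrable_comp_history k fun a => f (G a)

/-- Conditioning on the past: the next batch is independent of the history, so splitting over its
finitely many values replaces it by its law. -/
theorem IsBatchSampling.integral_history_next [IsProbabilityMeasure P]
    (hJ : IsBatchSampling P q J) (hq : ∀ j, 0 ≤ q j) (k : ℕ)
    (f : (Finset.range k → Fin m) → Fin m → ℝ) :
    ∫ ω, f (history J k ω) (J k ω) ∂P = ∑ j, q j * ∫ ω, f (history J k ω) j ∂P := by
  have hind : IndepFun (history J k) (J k) P := by
    have h := hJ.indep.indepFun_finset (Finset.range k) {k} (by simp) hJ.measurable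
    exact h.comp (φ := id) (ψ := fun a => a ⟨k, Finset.mem_singleton_self k⟩) measurable_id
      Measurable.of_discrete
  have hdec : ∀ ω, f (history J k ω) (J k ω) =
      ∑ j, f (history J k ω) j * (if J k ω = j then (1 : ℝ) else 0) := by
    intro ω
    simp
  have hone : ∀ j, ∫ ω, (if J k ω = j then (1 : ℝ) else 0) ∂P = q j := by
    intro j
    have hm : MeasurableSet {ω | J k ω = j} := hJ.measurable k (measurableSet_singleton j)
    have e : (fun ω => if J k ω = j then (1 : ℝ) else 0) = indicator {ω | J k ω = j} 1 := by
      ext ω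
      simp [indicator]
    rw [e, integral_indicator_one hm, Measure.real, hJ.law, ENNReal.toReal_ofReal (hq j)]
  have hprod : ∀ j, IndepFun (fun ω => f (history J k ω) j)
      (fun ω => if J k ω = j then (1 : ℝ) else 0) P := fun j =>
    hind.comp (φ := fun a => f a j) (ψ := fun i => if i = j then (1 : ℝ) else 0)
      Measurable.of_discrete Measurable.of_discrete
  have hint2 : ∀ j, Integrable (fun ω => if J k ω = j then (1 : ℝ) else 0) P := fun j =>
    (Integrable.of_finite (μ := P.map (J k)) (f := fun i => if i = j then (1 : ℝ) else 0)
      ).comp_measurable (hJ.measurable k)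
  have hint1 : ∀ j, Integrable (fun ω => f (history J k ω) j) P := fun j =>
    hJ.integrable_comp_history k fun a => f a j
  simp only [hdec]
  have hint : ∀ j, Integrable (fun ω => f (history J k ω) j * (if J k ω = j then (1 : ℝ) else 0)) P :=
    fun j => (hprod j).integrable_mul (hint1 j) (hint2 j)
  rw [integral_finsetSum _ fun j _ => hint j]
  refine Finset.sum_congr rfl fun j _ => ?_
  rw [(hprod j).integral_fun_mul_eq_mul_integral (hint1 j).aestronglyMeasurable
    (hint2 j).aestronglyMeasurable, hone, mul_comm]

/-- Double counting: each batch `B j` contributes `q j / |B j|` once for each of its elements. -/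
theorem Setting.sum_q {p : Fin n → ℝ} {Φ : H → EReal} (hS : Setting p φ Φ B q) :
    ∑ j, q j = 1 := by
  have h := hS.sum_p
  simp only [hS.p_eq, Finset.sum_filter] at h
  rw [Finset.sum_comm] at h
  rw [← h]
  refine Finset.sum_congr rfl fun j _ => ?_
  have : ((B j).card : ℝ) ≠ 0 := by
    exact_mod_cast (Finset.card_pos.2 (hS.batch_nonempty j)).ne'
  simp only [Finset.sum_ite_mem, Finset.univ_inter, Finset.sum_const, nsmul_eq_mul]
  field_simp

theorem Setting.batch_isProperConvexLSC {p : Fin n → ℝ} {Φ : H → EReal}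
    (hS : Setting p φ Φ B q) (j : Fin m) : IsProperConvexLSC (batchPotential φ (B j)) := by
  obtain ⟨x, hx⟩ := hS.potential.proper
  exact batchPotential_isProperConvexLSC hS.subpotential (hS.batch_nonempty j)
    ⟨x, fun i => hS.dom_subset i hx⟩

/-- One step of the scheme, compared with a fixed point `x` at which subgradients `ζ j` of the
batch potentials are given. -/
theorem IsBatchSampling.integral_step_le [CompleteSpace H] [IsProbabilityMeasure P]
    (hJ : IsBatchSampling P q J) {p : Fin n → ℝ} {Φ : H → EReal} (hS : Setting p φ Φ B q)
    (u₀ : H) {ε : ℝ} (hε : 0 < ε) (k : ℕ) {x : H} {ζ : Fin m → H}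
    (hζ : ∀ j, ζ j ∈ subdiff (batchPotential φ (B j)) x) :
    ∫ ω, ‖proxSeq φ B u₀ ε (fun i => J i ω) (k + 1) - x‖ ^ 2 ∂P ≤
      ∫ ω, ‖proxSeq φ B u₀ ε (fun i => J i ω) k - x - ε • ∑ j, q j • ζ j‖ ^ 2 ∂P +
        ε ^ 2 * ∑ j, q j * ‖ζ j - ∑ i, q i • ζ i‖ ^ 2 := by
  have : Nonempty Ω := P.nonempty_of_neZero
  obtain ⟨G, hG⟩ := exists_proxSeq_eq_history φ B J u₀ ε k
  have hint := fun f => hJ.integrable_comp_history k f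
  simp only [proxSeq, hG]
  rw [hJ.integral_history_next (fun j => (hS.q_pos j).le) k fun a j =>
    ‖proxPoint (batchPotential φ (B j)) ε (G a) - x‖ ^ 2]
  calc ∑ j, q j * ∫ ω, ‖proxPoint (batchPotential φ (B j)) ε (G (history J k ω)) - x‖ ^ 2 ∂P
      ≤ ∑ j, q j * ∫ ω, ‖G (history J k ω) - x - ε • ζ j‖ ^ 2 ∂P := by
        refine Finset.sum_le_sum fun j _ => mul_le_mul_of_nonneg_left ?_ (hS.q_pos j).le
        refine integral_mono
          (hint fun a => ‖proxPoint (batchPotential φ (B j)) ε (G a) - x‖ ^ 2)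
          (hint fun a => ‖G a - x - ε • ζ j‖ ^ 2) fun ω => ?_
        have := norm_proxPoint_sub_le (hS.batch_isProperConvexLSC j)
          (batchPotential_bddBelow (fun i => (hS.subpotential i).ne_bot) hS.bddBelow (B j)) hε
          (G (history J k ω)) (hζ j)
        dsimp only
        gcongr
    _ = ∫ ω, ∑ j, q j * ‖G (history J k ω) - x - ε • ζ j‖ ^ 2 ∂P := by
        rw [integral_finsetSum _ fun j _ => hint fun a => q j * ‖G a - x - ε • ζ j‖ ^ 2]
        simp only [integral_const_mul]
    _ = _ := by
        simp only [sum_mul_norm_sub_smul_sq hS.sum_q]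
        rw [integral_add (hint fun a => ‖G a - x - ε • ∑ j, q j • ζ j‖ ^ 2)
          (integrable_const _)]
        simp

end Sampling

end MiniBatch

/-! ### Error estimates along the flow. -/

namespace MiniBatch

/-- The inequality defining the index is strict, so at `t = k ε` the value is already `w_{k+1}`; in
particular `w_ε(0) = w₁`. -/
theorem stepIndex_eq {ε t : ℝ} (hε : 0 < ε) (ht : 0 ≤ t) : stepIndex ε t = ⌊t / ε⌋₊ + 1 := by
  have hset : {k : ℕ | t < k * ε} = Ici (⌊t / ε⌋₊ + 1) := by
    ext k
    rw [mem_ofPred_eq, mem_Ici, ← div_lt_iff₀ hε, ← Nat.floor_lt (by positivity), Nat.succ_le_iff]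
  rw [stepIndex, hset]
  exact csInf_Ici

variable {H : Type*} [NormedAddCommGroup H] [InnerProductSpace ℝ H] [CompleteSpace H]
  {Ω : Type*} [MeasurableSpace Ω] {P : Measure Ω} [IsProbabilityMeasure P]
  {n m : ℕ} {p : Fin n → ℝ} {φ : Fin n → H → EReal} {Φ : H → EReal}
  {B : Fin m → Finset (Fin n)} {q : Fin m → ℝ} {ξ : Fin m → H → H}
  {J : ℕ → Ω → Fin m} {u₀ : H} {u : ℝ → H}

/-- One step of the scheme, compared with the gradient flow at time `t`. -/
theorem integral_step_flow_le (hS : Setting p φ Φ B q) (hξ : IsSplitting φ Φ B q ξ)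
    (hJ : IsBatchSampling P q J) (hu : IsGradientFlow Φ u₀ u) (hC1 : ContDiffOn ℝ 1 u (Ici 0))
    {ε t : ℝ} (hε : 0 < ε) (ht : 0 ≤ t) (k : ℕ) :
    ∫ ω, ‖proxSeq φ B u₀ ε (fun i => J i ω) (k + 1) - u t‖ ^ 2 ∂P ≤
      ∫ ω, ‖proxSeq φ B u₀ ε (fun i => J i ω) k - u t + ε • derivWithin u (Ici 0) t‖ ^ 2 ∂P +
        ε ^ 2 * Lam Φ q ξ (u t) := by
  have hdom : u t ∈ domSubdiff Φ := ⟨_, hu.neg_derivWithin_mem hS.potential hC1 ht⟩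
  obtain ⟨h1, h2⟩ := hξ (u t) hdom
  have h3 := hu.minSubgrad_eq_neg_derivWithin hS.potential hC1 ht
  have h := hJ.integral_step_le hS u₀ hε k h1
  rw [← h2] at h
  simp only [Lam]
  convert h using 6 with ω
  rw [h3, smul_neg, sub_neg_eq_add]

/-- The discrete Gronwall estimate at the grid points. -/
theorem integral_grid_le (hS : Setting p φ Φ B q) (hξ : IsSplitting φ Φ B q ξ)
    (hJ : IsBatchSampling P q J) (hu : IsGradientFlow Φ u₀ u) (hC1 : ContDiffOn ℝ 1 u (Ici 0))
    {ε T M ρ : ℝ} (hε : 0 < ε) (hM : ∀ t ∈ Icc 0 T, Lam Φ q ξ (u t) ≤ M)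
    (hρ : ∀ s ∈ Icc 0 T, ∀ t ∈ Icc 0 T, |s - t| ≤ ε →
      ‖derivWithin u (Ici 0) s - derivWithin u (Ici 0) t‖ ≤ ρ) (k : ℕ) (hk : k * ε ≤ T) :
    ∫ ω, ‖proxSeq φ B u₀ ε (fun i => J i ω) k - u (k * ε)‖ ^ 2 ∂P ≤
      ((1 + ε) ^ k - 1) * ((1 + ε) * ρ ^ 2 + ε * M) := by
  induction k with
  | zero => simp [proxSeq, hu.initial]
  | succ k ih =>
    set v := derivWithin u (Ici 0)
    set W := fun ω => proxSeq φ B u₀ ε (fun i => J i ω) k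
    push_cast at hk ⊢
    have hkT : k * ε ≤ T := by linarith
    have hk0 : 0 ≤ k * ε := by positivity
    set s := k * ε with hs
    have ht : ((k : ℝ) + 1) * ε = s + ε := by rw [hs]; ring
    rw [ht] at hk ⊢
    have hmem : ∀ r ∈ Icc s (s + ε), r ∈ Icc 0 T := fun r hr => ⟨hk0.trans hr.1, hr.2.trans hk⟩
    have hst : s ≤ s + ε := by linarith
    have htay : ‖u (s + ε) - u s - ε • v (s + ε)‖ ≤ ρ * ε := by
      have h := norm_sub_sub_smul_le (u := u) (v := v) (s := s) (t := s + ε) (ρ := ρ) hst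
        (fun r hr => (hasDerivWithinAt_of_contDiffOn hC1 (hk0.trans hr.1)).mono
          fun x hx => hk0.trans hx.1)
        (fun r hr => hρ r (hmem r hr) _ (hmem _ (right_mem_Icc.2 hst))
          (abs_le.2 ⟨by linarith [hr.1], by linarith [hr.2]⟩))
      simpa using h
    -- The step is implicit, so the comparison is made at the right endpoint `s + ε`; going back to
    -- `u s` costs only the Taylor remainder.
    have hstep := integral_step_flow_le hS hξ hJ hu hC1 hε (t := s + ε) (by linarith) k
    have hΛ := hM (s + ε) (hmem _ (right_mem_Icc.2 hst))
    have hint := fun f => hJ.integrable_comp_proxSeq (φ := φ) (B := B) u₀ ε k f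
    have hmain : ∫ ω, ‖W ω - u (s + ε) + ε • v (s + ε)‖ ^ 2 ∂P ≤
        (1 + ε) * ∫ ω, ‖W ω - u s‖ ^ 2 ∂P + (1 + ε⁻¹) * (ρ * ε) ^ 2 := by
      calc _ ≤ ∫ ω, ((1 + ε) * ‖W ω - u s‖ ^ 2 + (1 + ε⁻¹) * (ρ * ε) ^ 2) ∂P := by
            refine integral_mono (hint fun w => ‖w - u (s + ε) + ε • v (s + ε)‖ ^ 2)
              (hint fun w => (1 + ε) * ‖w - u s‖ ^ 2 + (1 + ε⁻¹) * (ρ * ε) ^ 2) fun ω => ?_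
            have e : W ω - u (s + ε) + ε • v (s + ε) =
                (W ω - u s) + -(u (s + ε) - u s - ε • v (s + ε)) := by abel
            dsimp only
            rw [e]
            refine (norm_add_sq_le_of_pos _ _ hε).trans ?_
            rw [norm_neg]
            gcongr
        _ = _ := by
            rw [integral_add (hint fun w => (1 + ε) * ‖w - u s‖ ^ 2) (integrable_const _),
              integral_const_mul]
            simp [W]
    have hk1 := ih hkT
    have e1 : (1 + ε⁻¹) * (ρ * ε) ^ 2 = ε * ((1 + ε) * ρ ^ 2) := by
      field_simp
      ring
    rw [e1] at hmain
    have h1 : ε ^ 2 * Lam Φ q ξ (u (s + ε)) ≤ ε ^ 2 * M := by gcongr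
    have h2 := mul_le_mul_of_nonneg_left hk1 (show 0 ≤ 1 + ε by linarith)
    -- The claimed bound solves the recursion with equality, starting from zero.
    have e2 : ((1 + ε) ^ (k + 1) - 1) * ((1 + ε) * ρ ^ 2 + ε * M) =
        (1 + ε) * (((1 + ε) ^ k - 1) * ((1 + ε) * ρ ^ 2 + ε * M)) +
          ε * ((1 + ε) * ρ ^ 2) + ε ^ 2 * M := by ring
    linarith

/-- The error estimate in terms of a modulus of continuity `ρ` of `u'` at scale `ε`. -/
theorem exists_integral_wEps_le (hS : Setting p φ Φ B q) (hξ : IsSplitting φ Φ B q ξ)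
    (hJ : IsBatchSampling P q J) (hu : IsGradientFlow Φ u₀ u)
    (hΛ : LocBddOnNonneg fun t => Lam Φ q ξ (u t)) (hC1 : ContDiffOn ℝ 1 u (Ici 0))
    {T : ℝ} (hT : 0 < T) : ∃ C : ℝ, 0 < C ∧ ∀ ε : ℝ, 0 < ε → ∀ ρ : ℝ,
      (∀ s ∈ Icc 0 T, ∀ t ∈ Icc 0 T, |s - t| ≤ ε →
        ‖derivWithin u (Ici 0) s - derivWithin u (Ici 0) t‖ ≤ ρ) →
      ∀ t ∈ Icc 0 T,
        ∫ ω, ‖wEps φ B u₀ J ε t ω - u t‖ ^ 2 ∂P ≤ C * (ρ ^ 2 + ε ^ 2 + ε) := by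
  obtain ⟨M, hM⟩ := hΛ T hT
  have hM0 : 0 ≤ M := (abs_nonneg _).trans (hM 0 (left_mem_Icc.2 hT.le))
  have hM' : ∀ t ∈ Icc 0 T, Lam Φ q ξ (u t) ≤ M := fun t ht => (le_abs_self _).trans (hM t ht)
  set v := derivWithin u (Ici 0)
  obtain ⟨D, hD⟩ := isCompact_Icc.exists_bound_of_continuousOn
    ((continuousOn_derivWithin_of_contDiffOn hC1).mono (fun _ hx => hx.1 : Icc (0 : ℝ) T ⊆ Ici 0))
  have hD0 : 0 ≤ D := (norm_nonneg _).trans (hD 0 (left_mem_Icc.2 hT.le))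
  set K := Real.exp T
  have hK : 0 < K := Real.exp_pos T
  -- The sum of the coefficients `4K(1+T)` of `ρ²`, `4KM` of `ε` and `6D² + 2M` of `ε²` obtained
  -- below.
  refine ⟨4 * K * (1 + T) + 4 * K * M + 6 * D ^ 2 + 2 * M, by positivity,
    fun ε hε ρ hρ t ht => ?_⟩
  rw [show (fun ω => ‖wEps φ B u₀ J ε t ω - u t‖ ^ 2) = fun ω =>
    ‖proxSeq φ B u₀ ε (fun i => J i ω) (⌊t / ε⌋₊ + 1) - u t‖ ^ 2 from by
      simp only [wEps, stepIndex_eq hε ht.1]]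
  set k := ⌊t / ε⌋₊
  have hkt : k * ε ≤ t := by
    rw [← le_div_iff₀ hε]
    exact Nat.floor_le (div_nonneg ht.1 hε.le)
  have htk : t ≤ k * ε + ε := by
    have := (Nat.lt_floor_add_one (t / ε)).le
    rw [div_le_iff₀ hε] at this
    linarith
  have hk0 : 0 ≤ k * ε := by positivity
  have hkT : k * ε ∈ Icc 0 T := ⟨hk0, hkt.trans ht.2⟩
  set E := ∫ ω, ‖proxSeq φ B u₀ ε (fun i => J i ω) k - u (k * ε)‖ ^ 2 ∂P with hE
  have hEk : E ≤ K * ((1 + T) * ρ ^ 2 + ε * M) := by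
    -- For `k = 0` the step may exceed `T`, but the error is zero; for `k ≥ 1`, `ε ≤ T` allows
    -- replacing `1 + ε` by `1 + T`.
    rcases Nat.eq_zero_or_pos k with h0 | h0
    · have : E = 0 := by simp [hE, h0, proxSeq, hu.initial]
      rw [this]
      positivity
    · have hεT : ε ≤ T := by
        have : (1 : ℝ) ≤ k := by exact_mod_cast h0
        nlinarith [hkT.2]
      refine (integral_grid_le hS hξ hJ hu hC1 hε hM' hρ k hkT.2).trans ?_
      have hexp : (1 + ε) ^ k ≤ K := by
        calc (1 + ε) ^ k ≤ (Real.exp ε) ^ k := by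
              gcongr
              linarith [Real.add_one_le_exp ε]
          _ = Real.exp (k * ε) := (Real.exp_nat_mul ε k).symm
          _ ≤ K := Real.exp_le_exp.2 hkT.2
      have h1 : (1 + ε) ^ k - 1 ≤ K := by linarith
      gcongr
  have hint := fun l f => hJ.integrable_comp_proxSeq (φ := φ) (B := B) u₀ ε l f
  have hLip : ‖u (k * ε) - u t‖ ≤ D * ε := by
    have h := (convex_Icc 0 T).norm_image_sub_le_of_norm_hasDerivWithin_le (f := u) (f' := v)
      (fun r hr => (hasDerivWithinAt_of_contDiffOn hC1 hr.1).mono Icc_subset_Ici_self)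
      hD ht hkT
    refine h.trans ?_
    gcongr
    rw [Real.norm_eq_abs, abs_le]
    constructor <;> linarith
  -- The last step is compared with `u (k * ε)`, since `(k+1)ε` may lie beyond `T`, where the bounds
  -- are not available. This crude comparison occurs once and costs only order `ε²`.
  have h1 : ∫ ω, ‖proxSeq φ B u₀ ε (fun i => J i ω) (k + 1) - u t‖ ^ 2 ∂P ≤
      2 * ∫ ω, ‖proxSeq φ B u₀ ε (fun i => J i ω) (k + 1) - u (k * ε)‖ ^ 2 ∂P +
        2 * (D * ε) ^ 2 := by
    calc _ ≤ ∫ ω, (2 * ‖proxSeq φ B u₀ ε (fun i => J i ω) (k + 1) - u (k * ε)‖ ^ 2 +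
          2 * (D * ε) ^ 2) ∂P := by
          refine integral_mono (hint (k + 1) fun w => ‖w - u t‖ ^ 2)
            (hint (k + 1) fun w => 2 * ‖w - u (k * ε)‖ ^ 2 + 2 * (D * ε) ^ 2) fun ω => ?_
          dsimp only
          rw [← sub_add_sub_cancel _ (u (k * ε)) (u t)]
          refine (norm_add_sq_le_two _ _).trans ?_
          gcongr
      _ = _ := by
          rw [integral_add (hint (k + 1) fun w => 2 * ‖w - u (k * ε)‖ ^ 2) (integrable_const _),
            integral_const_mul]
          simp
  have h2 := integral_step_flow_le hS hξ hJ hu hC1 hε hk0 k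
  have h3 : ∫ ω, ‖proxSeq φ B u₀ ε (fun i => J i ω) k - u (k * ε) + ε • v (k * ε)‖ ^ 2 ∂P ≤
      2 * E + 2 * (ε * D) ^ 2 := by
    calc _ ≤ ∫ ω, (2 * ‖proxSeq φ B u₀ ε (fun i => J i ω) k - u (k * ε)‖ ^ 2 +
          2 * (ε * D) ^ 2) ∂P := by
          refine integral_mono (hint k fun w => ‖w - u (k * ε) + ε • v (k * ε)‖ ^ 2)
            (hint k fun w => 2 * ‖w - u (k * ε)‖ ^ 2 + 2 * (ε * D) ^ 2) fun ω => ?_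
          refine (norm_add_sq_le_two _ _).trans ?_
          rw [norm_smul, Real.norm_of_nonneg hε.le]
          have := hD _ hkT
          gcongr
      _ = _ := by
          rw [integral_add (hint k fun w => 2 * ‖w - u (k * ε)‖ ^ 2) (integrable_const _),
            integral_const_mul]
          simp [hE]
  have h4 : ε ^ 2 * Lam Φ q ξ (u (k * ε)) ≤ ε ^ 2 * M := by
    gcongr
    exact hM' _ hkT
  have h5 : 0 ≤ (4 * K * M + 6 * D ^ 2 + 2 * M) * ρ ^ 2 + (4 * K * (1 + T) + 4 * K * M) * ε ^ 2 +
      (4 * K * (1 + T) + 6 * D ^ 2 + 2 * M) * ε := by positivity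
  calc _ ≤ 4 * (K * ((1 + T) * ρ ^ 2 + ε * M)) + 6 * D ^ 2 * ε ^ 2 + 2 * M * ε ^ 2 := by
        linarith
    _ ≤ _ := by linarith

end MiniBatch

/-! ### Convergence and rate. -/

theorem theorem2p5 {H : Type*} [NormedAddCommGroup H] [InnerProductSpace ℝ H] [CompleteSpace H]
    {Ω : Type*} [MeasurableSpace Ω] (P : Measure Ω) [IsProbabilityMeasure P]
    {n m : ℕ} (p : Fin n → ℝ) (φ : Fin n → H → EReal) (Φ : H → EReal)
    (B : Fin m → Finset (Fin n)) (q : Fin m → ℝ) (hS : MiniBatch.Setting p φ Φ B q)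
    (ξ : Fin m → H → H) (hξ : MiniBatch.IsSplitting φ Φ B q ξ)
    (J : ℕ → Ω → Fin m) (hJ : MiniBatch.IsBatchSampling P q J)
    (u₀ : H) (hu₀ : u₀ ∈ MiniBatch.domSubdiff Φ)
    (u : ℝ → H) (hu : MiniBatch.IsGradientFlow Φ u₀ u)
    (hΛ : MiniBatch.LocBddOnNonneg (fun t => MiniBatch.Lam Φ q ξ (u t)))
    (hC1 : ContDiffOn ℝ 1 u (Ici 0)) :
    MiniBatch.IsMiniBatchMinimizingMovement P φ B u₀ J u ∧
    ∀ α : ℝ, 0 < α → α ≤ 1 →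
      MiniBatch.LocHolderOnNonneg α (derivWithin u (Ici 0)) →
      ∀ T : ℝ, 0 < T → ∃ c : ℝ, 0 < c ∧ ∀ ε : ℝ, 0 < ε → ∀ t ∈ Icc (0 : ℝ) T,
        ∫ ω, ‖MiniBatch.wEps φ B u₀ J ε t ω - u t‖ ^ 2 ∂P ≤
          c * (ε ^ (2 * α) + ε ^ 2 + ε) := by
  refine ⟨fun t ht => ⟨fun ε _ => ?_, ?_⟩, fun α hα _ hH T hT => ?_⟩
  · exact hJ.integrable_comp_proxSeq u₀ ε _ fun w => ‖w - u t‖ ^ 2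
  -- The horizon `t + 1` is positive even for `t = 0`.
  · obtain ⟨C, hC, hb⟩ := MiniBatch.exists_integral_wEps_le hS hξ hJ hu hΛ hC1 (T := t + 1) (by linarith)
    have huc := isCompact_Icc.uniformContinuousOn_of_continuous
      ((MiniBatch.continuousOn_derivWithin_of_contDiffOn hC1).mono
        (fun _ hx => hx.1 : Icc (0 : ℝ) (t + 1) ⊆ Ici 0))
    rw [Metric.uniformContinuousOn_iff] at huc
    refine tendsto_order.2 ⟨fun a ha => Eventually.of_forall fun ε =>
      ha.trans_le (integral_nonneg fun ω => by positivity), fun η hη => ?_⟩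
    -- With this modulus `C ρ² = η / 2`, leaving `η / 2` for the terms that vanish with `ε`.
    obtain ⟨δ, hδ, hδ'⟩ := huc (√(η / (2 * C))) (by positivity)
    have hlim : Tendsto (fun ε : ℝ => C * (η / (2 * C) + ε ^ 2 + ε)) (𝓝[>] 0) (𝓝 (η / 2)) := by
      have hcont : Continuous fun ε : ℝ => C * (η / (2 * C) + ε ^ 2 + ε) := by fun_prop
      have h := (hcont.tendsto 0).mono_left (nhdsWithin_le_nhds (s := Ioi 0))
      have e : C * (η / (2 * C) + 0 ^ 2 + 0) = η / 2 := by field_simp; simp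
      rwa [e] at h
    filter_upwards [Ioo_mem_nhdsGT hδ, hlim.eventually (gt_mem_nhds (half_lt_self hη))]
      with ε hε hlt
    have h := hb ε hε.1 (√(η / (2 * C))) (fun r hr s hs hrs => ?_) t ⟨ht, by linarith⟩
    · rw [Real.sq_sqrt (by positivity)] at h
      exact h.trans_lt hlt
    · rw [← dist_eq_norm]
      exact (hδ' r hr s hs ((Real.dist_eq r s).trans_le hrs |>.trans_lt hε.2)).le
  · obtain ⟨C, hC, hb⟩ := MiniBatch.exists_integral_wEps_le hS hξ hJ hu hΛ hC1 hT
    obtain ⟨L, hL⟩ := hH T hT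
    refine ⟨C * (L ^ 2 + 1), by positivity, fun ε hε t ht => ?_⟩
    -- `L` carries no sign, hence the absolute value. The summand `1` in `L ^ 2 + 1` keeps the
    -- constant positive and absorbs `ε ^ 2 + ε`.
    refine (hb ε hε (|L| * ε ^ α) (fun r hr s hs hrs => ?_) t ht).trans ?_
    · refine (hL r hr s hs).trans ?_
      gcongr
      exact le_abs_self L
    · have e : (|L| * ε ^ α) ^ 2 = L ^ 2 * ε ^ (2 * α) := by
        rw [mul_pow, sq_abs, ← Real.rpow_natCast (ε ^ α), ← Real.rpow_mul hε.le, mul_comm α]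
        simp
      have h0 : 0 ≤ ε ^ (2 * α) := by positivity
      rw [e, mul_assoc]
      gcongr
      nlinarith [sq_nonneg L, mul_nonneg (sq_nonneg L) (add_nonneg (sq_nonneg ε) hε.le)]
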